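/- Let $\mathbf{Y}$ and $\mathbf{D}$ be nonempty finite sets (observations and decisions), fix a linear order on $\mathbf{D}$, and let $1\le K<N$ be integers. Write $\mathfrak{P}(\mathbf{Y}^K)$ for the set of probability measures on $\mathbf{Y}^K$; for $P\in\mathfrak{P}(\mathbf{Y}^K)$ and a word $x\in\mathbf{Y}^j$ with $j\le K$, let $P(x)$ be the $P$-probability that the first $j$ coordinates form $x$. Write $a\wedge b=\min(a,b)$. The $K$-steps-ahead decision protocol is as follows. Sceptic's capital starts at $\mathcal{K}_0:=1$. For $n=1,\dots,N$: Reality announces $\lambda_n:\mathbf{D}\times\mathbf{Y}^K\to[0,1]$; Forecaster announces $P_n\in\mathfrak{P}(\mathbf{Y}^K)$; if $n>1$, $$\mathcal{K}_{n-1}:=\mathcal{K}_{n-2}+\sum_{x\in\mathbf{Y}^{(K-1)\wedge(N-n+1)}}f_{n-1}(y_{n-1}x)P_n(x)-\sum_{x\in\mathbf{Y}^{K\wedge(N-n+2)}}f_{n-1}(x)P_{n-1}(x);$$ Decision Maker announces $d_n\in\mathbf{D}$; Sceptic announces $f_n\in\mathbb{R}^{\mathbf{Y}^{K\wedge(N-n+1)}}$;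 Reality announces $y_n\in\mathbf{Y}$; and if $n=N$, $\mathcal{K}_N:=\mathcal{K}_{N-1}+f_N(y_N)-\sum_{y\in\mathbf{Y}}f_N(y)P_N(y)$. All moves are made with knowledge of all previous moves. For an event $E$ (a set of sequences $(\lambda_1,P_1,d_1,y_1,\dots,\lambda_N,P_N,d_N,y_N)$ of moves of the players other than Sceptic), the upper game-theoretic probability $\overline{\mathbb{P}}(E)$ is the infimum of the $\alpha>0$ for which Sceptic has a strategy that guarantees $\mathcal{K}_n\ge0$ for all $n$ whatever the other players do, and $\alpha\mathcal{K}_N\ge1$ whenever $E$ happens. A strategy $A$ for Decision Maker is a function prescribing a decision $d^A_n=A(\lambda_1,P_1,y_1,\dots,\lambda_{n-1},P_{n-1},y_{n-1},\lambda_n,P_n)$ at each step $n$. Put $$\mathrm{Loss}_N:=\sum_{n=1}^{N-K+1}\lambda_n(d_n,y_n\dots y_{n+K-1}),\qquad \mathrm{Loss}_N(A):=\sum_{n=1}^{N-K+1}\lambda_n(d^A_n,y_n\dots y_{n+K-1}).$$ The Bayes strategy is the strategy for which $d^A_n$ is the first element, in the fixed order, of $\arg\min_{d\in\mathbf{D}}\sum_{x\in\mathbf{Y}^K}\lambda_n(d,x)P_n(x)$.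 **Theorem.** There is a strategy $A$ for Decision Maker, namely the Bayes strategy, such that: (i) for every $\epsilon\in(0,0.3)$, $$\overline{\mathbb{P}}\left(\mathrm{Loss}_N(A)-\mathrm{Loss}_N\ge2\sqrt{KN\ln\tfrac1\epsilon}\right)\le\epsilon;$$ (ii) for every $\delta>0$, $$\overline{\mathbb{P}}\left(\tfrac1N\mathrm{Loss}_N(A)-\tfrac1N\mathrm{Loss}_N\ge\delta\right)\le5\,\frac{K}{\delta^2N}\exp\left(-\frac{\delta^2N}{4K}\right);$$ (iii) for every strategy $B$ for Decision Maker and every $\delta>0$, the bound in (ii) also holds with $\mathrm{Loss}_N(B)$ in place of $\mathrm{Loss}_N$. -/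

import Mathlib

namespace KStep

/-- Words `x ∈ Y^k`. -/
abbrev Word (Y : Type*) (k : ℕ) : Type _ := Fin k → Y

/-- Loss functions `D × Y^K → [0,1]`. -/
abbrev LossFn (Y D : Type*) (K : ℕ) : Type _ := D → Word Y K → Set.Icc (0 : ℝ) 1

/-- Probability measures on the finite set `Y^K`, given by their probability mass functions. -/
abbrev Forecast (Y : Type*) [Fintype Y] (K : ℕ) : Type _ := stdSimplex ℝ (Word Y K)

/-- The moves of the players other than Sceptic in one round: Reality's loss function,
Forecaster's forecast, Decision Maker's decision, Reality's observation. -/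
structure Round (Y D : Type*) [Fintype Y] (K : ℕ) where
  loss : LossFn Y D K
  forecast : Forecast Y K
  decision : D
  obs : Y

/-- The game-theoretic sample space: all sequences of `N` rounds. The rounds are numbered
`0, …, N - 1` here, so index `n` stands for step `n + 1`. -/
abbrev Play (Y D : Type*) [Fintype Y] (K N : ℕ) : Type _ := Fin N → Round Y D K

/-- A strategy for Decision Maker: the decision at each step as a function of the previous moves
of Reality and Forecaster, `λ₁, P₁, y₁, …, λₙ₋₁, Pₙ₋₁, yₙ₋₁`, and of `λₙ`, `Pₙ`. -/
abbrev DMStrategy (Y D : Type*) [Fintype Y] (K N : ℕ) : Type _ :=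
  (n : Fin N) → (Fin n → LossFn Y D K × Forecast Y K × Y) → LossFn Y D K → Forecast Y K → D

/-- A strategy for Sceptic: his move, a function on words of length `min K (N - n)` (the
observations at most `K` steps ahead and not beyond the horizon), as a function of all previous
rounds and of the current loss function, forecast and decision. -/
abbrev ScepticStrategy (Y D : Type*) [Fintype Y] (K N : ℕ) : Type _ :=
  (n : Fin N) → (Fin n → Round Y D K) → LossFn Y D K → Forecast Y K → D →
    (Word Y (min K (N - n)) → ℝ)

/-- `P(x)` for a word `x` of length `j ≤ K`: the `P`-probability that the first `j` of the `K`
predicted observations are `x`. -/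
noncomputable def prefixProb {Y : Type*} [Fintype Y] {K j : ℕ} (P : Forecast Y K) (hj : j ≤ K)
    (x : Word Y j) : ℝ :=
  open Classical in
  ∑ z : Word Y K, if (fun i => z (Fin.castLE hj i)) = x then P.1 z else 0

/-- The word `y x`, read as a word of length `k` (used with `k = j + 1`). -/
def prepend {Y : Type*} {j k : ℕ} (h : k ≤ j + 1) (y : Y) (x : Word Y j) : Word Y k :=
  fun i => (Fin.cons y x : Word Y (j + 1)) (Fin.castLE h i)

section Game

variable {Y D : Type*} [Fintype Y] {K N : ℕ}

/-- Sceptic's move `fₙ` in the play `ω`. -/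
def ScepticStrategy.move (S : ScepticStrategy Y D K N) (ω : Play Y D K N) (n : Fin N) :
    Word Y (min K (N - n)) → ℝ :=
  S n (fun i => ω ⟨i, i.2.trans n.2⟩) (ω n).loss (ω n).forecast (ω n).decision

/-- The decision `dₙ^A` prescribed by the strategy `A` in the play `ω`. -/
def DMStrategy.decision (A : DMStrategy Y D K N) (ω : Play Y D K N) (n : Fin N) : D :=
  A n (fun i => ((ω ⟨i, i.2.trans n.2⟩).loss, (ω ⟨i, i.2.trans n.2⟩).forecast,
    (ω ⟨i, i.2.trans n.2⟩).obs)) (ω n).loss (ω n).forecast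

/-- What Sceptic receives for the tickets `fₙ`: before the last step they are sold at the prices
of the next forecast, `∑ₓ fₙ(yₙ x) Pₙ₊₁(x)`; at the last step he receives `fₙ(yₙ)`. -/
noncomputable def resale (S : ScepticStrategy Y D K N) (ω : Play Y D K N) (n : Fin N) : ℝ :=
  if h : n.1 + 1 < N then
    ∑ x : Word Y (min (K - 1) (N - (n.1 + 1))),
      S.move ω n (prepend (by omega) (ω n).obs x) *
        prefixProb (ω ⟨n.1 + 1, h⟩).forecast (by omega) x
  else
    S.move ω n (fun _ => (ω n).obs)

/-- What Sceptic pays for the tickets `fₙ`: `∑ₓ fₙ(x) Pₙ(x)`. -/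
noncomputable def cost (S : ScepticStrategy Y D K N) (ω : Play Y D K N) (n : Fin N) : ℝ :=
  ∑ x : Word Y (min K (N - n)),
    S.move ω n x * prefixProb (ω n).forecast (min_le_left K (N - n)) x

/-- Sceptic's capital `𝒦ₙ`, `n = 0, …, N` (constant after `N`). -/
noncomputable def capital (S : ScepticStrategy Y D K N) (ω : Play Y D K N) : ℕ → ℝ
  | 0 => 1
  | n + 1 => capital S ω n + if h : n < N then resale S ω ⟨n, h⟩ - cost S ω ⟨n, h⟩ else 0

/-- The upper game-theoretic probability of an event `E`: the infimum of the `α > 0` such that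
Sceptic has a strategy that keeps his capital nonnegative on all plays and makes the final capital
at least `1 / α` on all plays in `E`. -/
noncomputable def upperProb (E : Set (Play Y D K N)) : ℝ :=
  sInf {α : ℝ | 0 < α ∧ ∃ S : ScepticStrategy Y D K N,
    (∀ ω : Play Y D K N, ∀ n ≤ N, 0 ≤ capital S ω n) ∧ ∀ ω ∈ E, 1 ≤ α * capital S ω N}

/-- The total loss of the decisions `e` against the moves of Reality in `ω`. The sum is over the
steps at which all `K` observations that determine the loss are within the horizon. -/
noncomputable def totalLoss (ω : Play Y D K N) (e : Fin N → D) : ℝ :=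
  ∑ n : Fin N, if h : n.1 + K ≤ N then
    ((ω n).loss (e n) (fun i => (ω ⟨n.1 + i.1, by omega⟩).obs) : ℝ) else 0

/-- `Loss_N`: the loss of the decisions that Decision Maker actually makes. -/
noncomputable def actualLoss (ω : Play Y D K N) : ℝ := totalLoss ω fun n => (ω n).decision

/-- `Loss_N(A)`: the loss of the decisions prescribed by the strategy `A`. -/
noncomputable def strategyLoss (A : DMStrategy Y D K N) (ω : Play Y D K N) : ℝ :=
  totalLoss ω (A.decision ω)

/-- The expected loss of the decision `d`. -/
noncomputable def expectedLoss (l : LossFn Y D K) (P : Forecast Y K) (d : D) : ℝ :=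
  ∑ x : Word Y K, (l d x : ℝ) * P.1 x

/-- `A` is the Bayes strategy: it always chooses the first minimiser of the expected loss in the
given linear order on `D`. -/
def IsBayes [LinearOrder D] (A : DMStrategy Y D K N) : Prop :=
  ∀ n past l P, IsLeast {d | ∀ d', expectedLoss l P d ≤ expectedLoss l P d'} (A n past l P)

end Game

end KStep

/-!
The bounds come from a Hoeffding inequality for `K`-steps-ahead forecasts
(`KStep.upperProb_totalGain_le`), applied to the excess loss of the Bayes strategy `A` over a
competitor. Write `X b z` for the excess at step `b` if the next `K` observations are `z`. Then
`|X b z| ≤ 1`, and the mean of `X b` under the forecast at step `b` is at most `0`, because `A`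
minimises the expected loss.

A ticket on the block of observations `b, …, b + K - 1` can be bought at step `b` and held until
the block is complete, by selling it and buying back what remains of it at every step. So Sceptic
can split his capital equally among the residue classes modulo `K`, and in each class invest
everything in the ticket `exp (κ X b)`, normalised to price `1`, at each step `b` of the class: the
block before has been settled by then. The capital is always the market value of the tickets held
(`KStep.capital_holdTickets`), hence nonnegative.

By Hoeffding's inequality the normalising constant is at most `exp (κ ^ 2 / 2)`, and a class has at
most `N / K` blocks. With `κ = K η`, Jensen's inequality over the `K` classes shows that the final
capital is at least `exp (η S - η ^ 2 K N / 2)`, where `S` is the total excess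
(`KStep.exp_le_bundle_expTicket`). The best `η` gives upper probability at most
`exp (-C ^ 2 / (2 K N))` for the event `S ≥ C`. This is smaller than the bounds of the theorem: at
`C = 2 √(K N ln (1 / ε))` it is `ε ^ 2`, and at `C = δ N` it is `exp (-δ ^ 2 N / (2 K))`.
-/

namespace KStep

open Finset

/-! ### Observation sequences and finite expectations -/

section Words

variable {Y : Type*} {K : ℕ}

/-- The word of length `K` that starts at position `b` of the sequence `u`. -/
def window (K : ℕ) (u : ℕ → Y) (b : ℕ) : Word Y K := fun i => u (b + i)

/-- The sequence that agrees with `u` before position `n` and continues with the word `x`.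
The letters after the end of `x` are arbitrary. -/
noncomputable def splice [Nonempty Y] (u : ℕ → Y) (n : ℕ) {j : ℕ} (x : Word Y j) : ℕ → Y :=
  fun i => if i < n then u i else if h : i - n < j then x ⟨i - n, h⟩ else Classical.arbitrary Y

lemma splice_of_lt [Nonempty Y] (u : ℕ → Y) {n i j : ℕ} (x : Word Y j) (h : i < n) :
    splice u n x i = u i := by simp [splice, h]

lemma splice_add [Nonempty Y] (u : ℕ → Y) {n i j : ℕ} (x : Word Y j) (h : i < j) :
    splice u n x (n + i) = x ⟨i, h⟩ := by simp [splice, h]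

/-- The expectation of a function of the first `j` predicted observations can be computed from
their marginal distribution. -/
lemma sum_mul_prefixProb [Fintype Y] {j : ℕ} (P : Forecast Y K) (hj : j ≤ K)
    (g : Word Y j → ℝ) :
    ∑ x, g x * prefixProb P hj x = ∑ z : Word Y K, P.1 z * g (fun i => z (Fin.castLE hj i)) := by
  classical
  simp only [prefixProb, mul_sum]
  rw [sum_comm]
  refine sum_congr rfl fun z _ => ?_
  rw [sum_eq_single (fun i => z (Fin.castLE hj i))]
  · simp [mul_comm]
  · intro x _ hx
    simp [hx.symm]
  · simp

/-- Hoeffding's inequality for a bounded variable of nonpositive mean. The chord of `exp` over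
`[-κ, κ]` gives `exp (κ t) ≤ cosh κ + t * sinh κ`. -/
lemma sum_mul_exp_le [Fintype Y] (P : Forecast Y K) (X : Word Y K → ℝ)
    (hX : ∀ z, |X z| ≤ 1) (hmean : ∑ z, P.1 z * X z ≤ 0) {κ : ℝ} (hκ : 0 ≤ κ) :
    ∑ z, P.1 z * Real.exp (κ * X z) ≤ Real.exp (κ ^ 2 / 2) := by
  have hchord : ∀ t : ℝ, |t| ≤ 1 → Real.exp (κ * t) ≤ Real.cosh κ + t * Real.sinh κ := by
    intro t ht
    obtain ⟨h1, h2⟩ := abs_le.mp ht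
    have h := convexOn_exp.2 (Set.mem_univ κ) (Set.mem_univ (-κ))
      (show 0 ≤ (1 + t) / 2 by linarith) (show 0 ≤ (1 - t) / 2 by linarith) (by ring)
    simp only [smul_eq_mul] at h
    rw [Real.cosh_eq, Real.sinh_eq]
    calc Real.exp (κ * t) = Real.exp ((1 + t) / 2 * κ + (1 - t) / 2 * -κ) := by congr 1; ring
      _ ≤ _ := h
      _ = _ := by ring
  calc ∑ z, P.1 z * Real.exp (κ * X z)
      ≤ ∑ z, P.1 z * (Real.cosh κ + X z * Real.sinh κ) :=
        sum_le_sum fun z _ => mul_le_mul_of_nonneg_left (hchord _ (hX z)) (P.2.1 z)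
    _ = (∑ z, P.1 z) * Real.cosh κ + (∑ z, P.1 z * X z) * Real.sinh κ := by
        rw [sum_mul, sum_mul, ← sum_add_distrib]
        exact sum_congr rfl fun z _ => by ring
    _ ≤ Real.cosh κ := by
        have := mul_nonpos_of_nonpos_of_nonneg hmean (Real.sinh_nonneg_iff.mpr hκ)
        rw [P.2.2]
        linarith
    _ ≤ _ := Real.cosh_le_exp_half_sq κ

end Words

/-! ### Holding tickets on blocks of observations -/

section Tickets

variable {Y D : Type*} [Fintype Y] {K N : ℕ}

/-- A rule that attaches to every step `b` a function of the `K` observations starting at step `b`.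
It is chosen with the knowledge Sceptic has when he moves at step `b`. -/
abbrev BlockRule (Y D : Type*) [Fintype Y] (K N : ℕ) : Type _ :=
  (n : Fin N) → (Fin n → Round Y D K) → LossFn Y D K → Forecast Y K → D → Word Y K → ℝ

/-- The function of the observations that the rule `F` attaches to step `b` in the play `ω`. -/
def BlockRule.at (F : BlockRule Y D K N) (ω : Play Y D K N) (b : Fin N) : Word Y K → ℝ :=
  F b (fun i => ω ⟨i, i.2.trans b.2⟩) (ω b).loss (ω b).forecast (ω b).decision

lemma BlockRule.at_congr (F : BlockRule Y D K N) {ω ω' : Play Y D K N} {b : Fin N}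
    (hpast : ∀ i < b, ω i = ω' i) (hl : (ω b).loss = (ω' b).loss)
    (hP : (ω b).forecast = (ω' b).forecast) (hd : (ω b).decision = (ω' b).decision) :
    F.at ω b = F.at ω' b := by
  have : (fun i : Fin b => ω ⟨i, i.2.trans b.2⟩) = fun i : Fin b => ω' ⟨i, i.2.trans b.2⟩ :=
    funext fun i => hpast _ i.2
  simp only [BlockRule.at, this, hl, hP, hd]

/-- The steps before `n` in the residue class `k` modulo `K` whose block of `K` observations is
within the horizon. -/
def blockStarts (K N n k : ℕ) : Finset (Fin N) :=
  univ.filter fun b => b.1 < n ∧ b.1 % K = k ∧ b.1 + K ≤ N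

lemma mem_blockStarts {n k : ℕ} {b : Fin N} :
    b ∈ blockStarts K N n k ↔ b.1 < n ∧ b.1 % K = k ∧ b.1 + K ≤ N := by
  simp [blockStarts]

/-- The average over the `K` residue classes of the products of the tickets `F` bought before
step `n`, evaluated on the sequence of observations `u`. -/
noncomputable def bundle (F : BlockRule Y D K N) (ω : Play Y D K N) (n : ℕ) (u : ℕ → Y) : ℝ :=
  (∑ k ∈ range K, ∏ b ∈ blockStarts K N n k, F.at ω b (window K u b)) / K

lemma bundle_congr (F : BlockRule Y D K N) {ω ω' : Play Y D K N} {n : ℕ} {u u' : ℕ → Y}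
    (hF : ∀ b : Fin N, b.1 < n → F.at ω b = F.at ω' b)
    (hu : ∀ b i, b < n → b + K ≤ N → i < K → u (b + i) = u' (b + i)) :
    bundle F ω n u = bundle F ω' n u' := by
  unfold bundle
  congr 1
  refine sum_congr rfl fun k _ => prod_congr rfl fun b hb => ?_
  obtain ⟨hbn, -, hbN⟩ := mem_blockStarts.mp hb
  rw [hF b hbn]
  congr 1
  funext i
  exact hu b i hbn hbN i.2

lemma bundle_nonneg {F : BlockRule Y D K N} (hF : ∀ n h l P d z, 0 ≤ F n h l P d z)
    (ω : Play Y D K N) (n : ℕ) (u : ℕ → Y) : 0 ≤ bundle F ω n u :=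
  div_nonneg (sum_nonneg fun _ _ => prod_nonneg fun _ _ => hF _ _ _ _ _ _) (Nat.cast_nonneg K)

lemma bundle_zero (hK : 1 ≤ K) (F : BlockRule Y D K N) (ω : Play Y D K N) (u : ℕ → Y) :
    bundle F ω 0 u = 1 := by
  have hK' : (K : ℝ) ≠ 0 := by positivity
  simp [bundle, blockStarts, hK']

variable [Nonempty Y]

/-- The observations of a play as an infinite sequence, arbitrary from the horizon on. -/
noncomputable def obsSeq (ω : Play Y D K N) : ℕ → Y :=
  fun i => if h : i < N then (ω ⟨i, h⟩).obs else Classical.arbitrary Y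

lemma obsSeq_of_lt (ω : Play Y D K N) {i : ℕ} (h : i < N) : obsSeq ω i = (ω ⟨i, h⟩).obs := by
  simp [obsSeq, h]

/-- A play that starts with the given history and whose round `n` has the given loss function,
forecast and decision; everything else about it is arbitrary. -/
noncomputable def completion (n : Fin N) (past : Fin n → Round Y D K) (l : LossFn Y D K)
    (P : Forecast Y K) (d : D) : Play Y D K N :=
  fun i => if h : i < n then past ⟨i, h⟩ else ⟨l, P, d, Classical.arbitrary Y⟩

/-- The strategy that at step `n` holds the bundle of all tickets `F` bought up to step `n`. -/
noncomputable def holdTickets (F : BlockRule Y D K N) : ScepticStrategy Y D K N :=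
  fun n past l P d x =>
    bundle F (completion n past l P d) (n + 1) (splice (obsSeq (completion n past l P d)) n x)

lemma holdTickets_move (F : BlockRule Y D K N) (ω : Play Y D K N) (n : Fin N)
    (x : Word Y (min K (N - n))) :
    (holdTickets F).move ω n x = bundle F ω (n + 1) (splice (obsSeq ω) n x) := by
  set ω' := completion n (fun i => ω ⟨i, i.2.trans n.2⟩) (ω n).loss (ω n).forecast
    (ω n).decision with hω'
  have hpast : ∀ i < n, ω' i = ω i := fun i hi => by simp [hω', completion, hi]
  have hself : ω' n = ⟨(ω n).loss, (ω n).forecast, (ω n).decision, Classical.arbitrary Y⟩ := by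
    simp [hω', completion]
  change bundle F ω' (n + 1) (splice (obsSeq ω') n x) = _
  refine bundle_congr F (fun b hb => ?_) fun b i _ _ _ => ?_
  · rcases (Nat.lt_succ_iff.mp hb).lt_or_eq with h | h
    · refine F.at_congr (fun i hi => hpast i (hi.trans h)) ?_ ?_ ?_ <;> rw [hpast b h]
    · obtain rfl : b = n := Fin.ext h
      refine F.at_congr hpast ?_ ?_ ?_ <;> rw [hself]
  · unfold splice
    split_ifs with h1 h2
    · have hN := h1.trans n.2
      rw [obsSeq_of_lt _ hN, obsSeq_of_lt _ hN, hpast ⟨b + i, hN⟩ h1]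
    · rfl
    · rfl

/-- The market value of the bundle of tickets bought before step `n`: its expectation under the
forecast at step `n`, or its final value if `n` is the horizon. -/
noncomputable def bundleValue (F : BlockRule Y D K N) (ω : Play Y D K N) (n : ℕ) : ℝ :=
  if h : n < N then
    ∑ z : Word Y K, (ω ⟨n, h⟩).forecast.1 z * bundle F ω n (splice (obsSeq ω) n z)
  else bundle F ω N (obsSeq ω)

lemma resale_holdTickets (F : BlockRule Y D K N) (ω : Play Y D K N) (n : Fin N) :
    resale (holdTickets F) ω n = bundleValue F ω (n + 1) := by
  unfold resale bundleValue
  split_ifs with h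
  · rw [sum_mul_prefixProb (ω ⟨n.1 + 1, h⟩).forecast _
      (fun x => (holdTickets F).move ω n (prepend (by omega) (ω n).obs x))]
    refine sum_congr rfl fun z _ => ?_
    congr 1
    rw [holdTickets_move]
    refine bundle_congr F (fun _ _ => rfl) fun b i hb hbN hi => ?_
    rcases lt_trichotomy (b + i) n with hlt | heq | hgt
    · rw [splice_of_lt _ _ hlt, splice_of_lt _ _ (by omega)]
    · rw [heq, splice_of_lt _ _ (Nat.lt_succ_self _), obsSeq_of_lt _ n.2]
      exact splice_add (i := 0) (obsSeq ω) _ (show 0 < min K (N - n) by omega)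
    · obtain ⟨m, hm⟩ : ∃ m, b + i = n + (m + 1) := ⟨b + i - n - 1, by omega⟩
      rw [hm, splice_add _ _ (show m + 1 < min K (N - n) by omega),
        show n.1 + (m + 1) = n + 1 + m by omega, splice_add _ _ (show m < K by omega)]
      rfl
  · have hn : n.1 + 1 = N := by omega
    rw [holdTickets_move, hn]
    refine bundle_congr F (fun _ _ => rfl) fun b i hb hbN hi => ?_
    rcases lt_or_eq_of_le (show b + i ≤ n by omega) with hlt | heq
    · rw [splice_of_lt _ _ hlt]
    · rw [heq, obsSeq_of_lt _ n.2]
      exact splice_add (i := 0) (obsSeq ω) _ (by omega)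

/-- Buying the ticket of step `n` does not change the value of the bundle. Only the factor at `n`
of its own residue class is new, its price is `1`, and all earlier tickets of that class have been
settled by the observations before step `n`. -/
lemma sum_forecast_mul_bundle_succ {F : BlockRule Y D K N}
    (hF : ∀ n h l P d, ∑ z, P.1 z * F n h l P d z = 1) (ω : Play Y D K N) (n : Fin N) :
    ∑ z : Word Y K, (ω n).forecast.1 z * bundle F ω (n + 1) (splice (obsSeq ω) n z) =
      ∑ z : Word Y K, (ω n).forecast.1 z * bundle F ω n (splice (obsSeq ω) n z) := by
  simp only [bundle, ← mul_div_assoc, mul_sum, ← sum_div]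
  congr 1
  rw [sum_comm, sum_comm (s := univ)]
  refine sum_congr rfl fun k _ => ?_
  by_cases hk : n.1 % K = k ∧ n.1 + K ≤ N
  · have hins : blockStarts K N (n + 1) k = insert n (blockStarts K N n k) := by
      ext b
      simp only [mem_blockStarts, mem_insert, Fin.ext_iff]
      constructor
      · rintro ⟨h1, h2⟩
        rcases (Nat.lt_succ_iff.mp h1).lt_or_eq with h | h
        · exact .inr ⟨h, h2⟩
        · exact .inl h
      · rintro (h | ⟨h1, h2⟩)
        · rw [h]; exact ⟨by omega, hk⟩
        · exact ⟨by omega, h2⟩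
    have hnot : n ∉ blockStarts K N n k := fun h => by simp [mem_blockStarts] at h
    have hsettled : ∀ z : Word Y K,
        ∏ b ∈ blockStarts K N n k, F.at ω b (window K (splice (obsSeq ω) n z) b) =
          ∏ b ∈ blockStarts K N n k, F.at ω b (window K (obsSeq ω) b) := by
      intro z
      refine prod_congr rfl fun b hb => ?_
      obtain ⟨hbn, hbk, -⟩ := mem_blockStarts.mp hb
      have hbK : b.1 + K ≤ n := by
        -- `b < n` are congruent modulo `K`, hence at distance at least `K`
        have hdvd : K ∣ n - b := (Nat.modEq_iff_dvd' hbn.le).mp (hbk.trans hk.1.symm)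
        have := Nat.le_of_dvd (by omega) hdvd
        omega
      congr 1
      funext i
      exact splice_of_lt _ _ (by omega)
    have hnew : ∀ z : Word Y K, window K (splice (obsSeq ω) n z) n = z := fun z =>
      funext fun i => splice_add _ _ i.2
    simp only [hins, prod_insert hnot, hsettled, hnew, ← mul_assoc, ← sum_mul]
    rw [(ω n).forecast.2.2, BlockRule.at, hF]
  · have hsame : blockStarts K N (n + 1) k = blockStarts K N n k := by
      ext b
      simp only [mem_blockStarts]
      constructor
      · rintro ⟨h1, h2⟩
        rcases (Nat.lt_succ_iff.mp h1).lt_or_eq with h | h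
        · exact ⟨h, h2⟩
        · exact absurd (h ▸ h2) hk
      · exact fun ⟨h1, h2⟩ => ⟨by omega, h2⟩
    rw [hsame]

lemma cost_holdTickets {F : BlockRule Y D K N}
    (hF : ∀ n h l P d, ∑ z, P.1 z * F n h l P d z = 1) (ω : Play Y D K N) (n : Fin N) :
    cost (holdTickets F) ω n = bundleValue F ω n := by
  unfold cost bundleValue
  rw [sum_mul_prefixProb, dif_pos n.2, ← sum_forecast_mul_bundle_succ hF]
  refine sum_congr rfl fun z _ => ?_
  congr 1
  rw [holdTickets_move]
  refine bundle_congr F (fun _ _ => rfl) fun b i hb hbN hi => ?_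
  rcases lt_or_ge (b + i) n with hlt | hge
  · rw [splice_of_lt _ _ hlt, splice_of_lt _ _ hlt]
  · obtain ⟨m, hm⟩ := Nat.exists_eq_add_of_le hge
    rw [hm, splice_add _ _ (show m < min K (N - n) by omega),
      splice_add _ _ (show m < K by omega)]
    rfl

/-- Holding tickets of price `1` is self-financing: the capital is always the market value of the
tickets held. -/
lemma capital_holdTickets (hK : 1 ≤ K) (hN : 0 < N) {F : BlockRule Y D K N}
    (hF : ∀ n h l P d, ∑ z, P.1 z * F n h l P d z = 1) (ω : Play Y D K N) {n : ℕ} (hn : n ≤ N) :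
    capital (holdTickets F) ω n = bundleValue F ω n := by
  induction n with
  | zero =>
    rw [bundleValue, dif_pos hN]
    simp only [bundle_zero hK, mul_one]
    exact (ω ⟨0, hN⟩).forecast.2.2.symm
  | succ n ih =>
    rw [capital, dif_pos (Nat.lt_of_succ_le hn), ih (by omega), resale_holdTickets, cost_holdTickets hF]
    ring

lemma bundleValue_nonneg {F : BlockRule Y D K N} (hF : ∀ n h l P d z, 0 ≤ F n h l P d z)
    (ω : Play Y D K N) (n : ℕ) : 0 ≤ bundleValue F ω n := by
  unfold bundleValue
  split_ifs with h
  · exact sum_nonneg fun z _ =>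
      mul_nonneg ((ω ⟨n, h⟩).forecast.2.1 z) (bundle_nonneg hF _ _ _)
  · exact bundle_nonneg hF _ _ _

end Tickets

/-! ### Exponential tickets and the concentration inequality -/

section Concentration

variable {Y D : Type*} [Fintype Y] {K N : ℕ}

lemma upperProb_le {E : Set (Play Y D K N)} {α : ℝ} (hα : 0 < α) (S : ScepticStrategy Y D K N)
    (hS : ∀ ω, ∀ n ≤ N, 0 ≤ capital S ω n) (hE : ∀ ω ∈ E, 1 ≤ α * capital S ω N) :
    upperProb E ≤ α :=
  csInf_le ⟨0, fun _ h => h.1.le⟩ ⟨hα, S, hS, hE⟩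

/-- A residue class contains at most `N / K` starts of blocks within the horizon. -/
lemma card_blockStarts_le (hK : 1 ≤ K) (k : ℕ) : K * #(blockStarts K N N k) ≤ N := by
  have hcard : #(blockStarts K N N k) ≤ #(range (N / K)) := by
    refine card_le_card_of_injOn (fun b => b.1 / K) (fun b hb => ?_) fun b hb c hc hbc => ?_
    · obtain ⟨-, -, h⟩ := mem_blockStarts.mp hb
      have := Nat.div_le_div_right (c := K) h
      rw [Nat.add_div_right _ hK] at this
      exact mem_coe.mpr (mem_range.mpr this)
    · obtain ⟨-, hb, -⟩ := mem_blockStarts.mp hb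
      obtain ⟨-, hc, -⟩ := mem_blockStarts.mp hc
      apply Fin.ext
      rw [← Nat.div_add_mod b.1 K, ← Nat.div_add_mod c.1 K, hb, hc]
      exact congrArg (K * · + k) hbc
  rw [card_range] at hcard
  exact (Nat.mul_le_mul_left K hcard).trans (Nat.mul_div_le N K)

/-- The exponential ticket `exp (κ X)`, normalised to have price `1`. -/
noncomputable def expTicket (κ : ℝ) (X : BlockRule Y D K N) : BlockRule Y D K N :=
  fun n past l P d z =>
    Real.exp (κ * X n past l P d z) / ∑ w, P.1 w * Real.exp (κ * X n past l P d w)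

lemma sum_forecast_mul_exp_pos (P : Forecast Y K) (g : Word Y K → ℝ) :
    0 < ∑ z, P.1 z * Real.exp (g z) := by
  obtain ⟨z, -, hz⟩ : ∃ z ∈ univ, P.1 z ≠ 0 := by
    apply exists_ne_zero_of_sum_ne_zero
    rw [P.2.2]
    exact one_ne_zero
  exact sum_pos' (fun z _ => mul_nonneg (P.2.1 z) (Real.exp_pos _).le)
    ⟨z, mem_univ z, mul_pos ((P.2.1 z).lt_of_ne' hz) (Real.exp_pos _)⟩

lemma expTicket_nonneg (κ : ℝ) (X : BlockRule Y D K N) (n past l P d z) :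
    0 ≤ expTicket κ X n past l P d z :=
  div_nonneg (Real.exp_pos _).le (sum_forecast_mul_exp_pos P _).le

lemma sum_forecast_mul_expTicket (κ : ℝ) (X : BlockRule Y D K N) (n past l P d) :
    ∑ z, P.1 z * expTicket κ X n past l P d z = 1 := by
  simp only [expTicket, ← mul_div_assoc, ← sum_div]
  exact div_self (sum_forecast_mul_exp_pos P _).ne'

lemma le_expTicket {κ : ℝ} (hκ : 0 ≤ κ) {X : BlockRule Y D K N}
    (hX : ∀ n h l P d z, |X n h l P d z| ≤ 1)
    (hmean : ∀ n h l P d, ∑ z, P.1 z * X n h l P d z ≤ 0) (n past l P d z) :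
    Real.exp (κ * X n past l P d z - κ ^ 2 / 2) ≤ expTicket κ X n past l P d z := by
  rw [Real.exp_sub]
  exact div_le_div_of_nonneg_left (Real.exp_pos _).le (sum_forecast_mul_exp_pos P _)
    (sum_mul_exp_le P _ (hX n past l P d) (hmean n past l P d) hκ)

variable [Nonempty Y]

/-- The total gain of the rule `X` over all blocks within the horizon. -/
noncomputable def totalGain (X : BlockRule Y D K N) (ω : Play Y D K N) : ℝ :=
  ∑ b : Fin N, if b.1 + K ≤ N then X.at ω b (window K (obsSeq ω) b) else 0

lemma totalGain_eq_sum_blockStarts (hK : 1 ≤ K) (X : BlockRule Y D K N) (ω : Play Y D K N) :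
    totalGain X ω =
      ∑ k ∈ range K, ∑ b ∈ blockStarts K N N k, X.at ω b (window K (obsSeq ω) b) := by
  rw [totalGain, ← sum_filter, ← sum_fiberwise_of_maps_to (g := fun b => b.1 % K) (t := range K)
    (fun b _ => mem_range.mpr (Nat.mod_lt _ hK))]
  refine sum_congr rfl fun k _ => sum_congr ?_ fun _ _ => rfl
  ext b
  simp [mem_blockStarts, and_comm]

/-- The final value of the exponential tickets. Each residue class contributes the exponential of
its own share of the gain, and Jensen's inequality bounds the average below by the exponential of
the average, which involves the total gain. -/
lemma exp_le_bundle_expTicket (hK : 1 ≤ K) {η : ℝ} (hη : 0 ≤ η) {X : BlockRule Y D K N}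
    (hX : ∀ n h l P d z, |X n h l P d z| ≤ 1)
    (hmean : ∀ n h l P d, ∑ z, P.1 z * X n h l P d z ≤ 0) (ω : Play Y D K N) :
    Real.exp (η * totalGain X ω - η ^ 2 * (K * N) / 2) ≤
      bundle (expTicket (K * η) X) ω N (obsSeq ω) := by
  have hK0 : (0 : ℝ) < K := by exact_mod_cast hK
  set s : ℕ → ℝ := fun k => ∑ b ∈ blockStarts K N N k, X.at ω b (window K (obsSeq ω) b)
  have hclass : ∀ k, Real.exp (K * η * s k - η ^ 2 * (K * N) / 2) ≤
      ∏ b ∈ blockStarts K N N k, (expTicket (K * η) X).at ω b (window K (obsSeq ω) b) := by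
    intro k
    calc Real.exp (K * η * s k - η ^ 2 * (K * N) / 2)
        ≤ Real.exp (∑ b ∈ blockStarts K N N k,
            (K * η * X.at ω b (window K (obsSeq ω) b) - (K * η) ^ 2 / 2)) := by
          rw [sum_sub_distrib, ← mul_sum, sum_const, nsmul_eq_mul]
          have hcard : (K : ℝ) * #(blockStarts K N N k) ≤ N := by
            exact_mod_cast card_blockStarts_le hK k
          have := mul_le_mul_of_nonneg_left hcard (show 0 ≤ η ^ 2 * K / 2 by positivity)
          apply Real.exp_le_exp.mpr
          linarith
      _ = ∏ b ∈ blockStarts K N N k,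
            Real.exp (K * η * X.at ω b (window K (obsSeq ω) b) - (K * η) ^ 2 / 2) :=
          Real.exp_sum _ _
      _ ≤ _ := prod_le_prod (fun _ _ => (Real.exp_pos _).le) fun b _ =>
          le_expTicket (by positivity) hX hmean _ _ _ _ _ _
  have hjensen := convexOn_exp.map_sum_le (t := range K) (w := fun _ => (1 : ℝ) / K)
    (p := fun k => K * η * s k - η ^ 2 * (K * N) / 2) (fun _ _ => by positivity)
    (by simp [hK0.ne']) (fun _ _ => Set.mem_univ _)
  simp only [smul_eq_mul, ← mul_sum] at hjensen
  calc Real.exp (η * totalGain X ω - η ^ 2 * (K * N) / 2)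
      = Real.exp (1 / K * ∑ k ∈ range K, (K * η * s k - η ^ 2 * (K * N) / 2)) := by
        rw [show totalGain X ω = ∑ k ∈ range K, s k from totalGain_eq_sum_blockStarts hK X ω,
          sum_sub_distrib, ← mul_sum, sum_const, card_range, nsmul_eq_mul]
        congr 1
        field_simp
    _ ≤ 1 / K * ∑ k ∈ range K, Real.exp (K * η * s k - η ^ 2 * (K * N) / 2) := hjensen
    _ ≤ _ := by
        rw [bundle, one_div_mul_eq_div]
        exact div_le_div_of_nonneg_right (sum_le_sum fun k _ => hclass k) hK0.le

/-- The game-theoretic Hoeffding inequality for `K`-steps-ahead forecasts. -/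
lemma upperProb_totalGain_le (hK : 1 ≤ K) (hN : 0 < N) {X : BlockRule Y D K N}
    (hX : ∀ n h l P d z, |X n h l P d z| ≤ 1)
    (hmean : ∀ n h l P d, ∑ z, P.1 z * X n h l P d z ≤ 0) {C : ℝ} (hC : 0 ≤ C) :
    upperProb {ω | C ≤ totalGain X ω} ≤ Real.exp (-(C ^ 2 / (2 * (K * N)))) := by
  have hK0 : (0 : ℝ) < K := by exact_mod_cast hK
  have hN0 : (0 : ℝ) < N := by exact_mod_cast hN
  -- this value of `η` maximises `η * C - η ^ 2 * (K * N) / 2`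
  set η : ℝ := C / (K * N) with hη
  have hη0 : 0 ≤ η := by positivity
  have hcap := fun ω n (hn : n ≤ N) => capital_holdTickets hK hN
    (sum_forecast_mul_expTicket (K * η) X) ω hn
  refine upperProb_le (Real.exp_pos _) (holdTickets (expTicket (K * η) X)) (fun ω n hn => ?_)
    fun ω hω => ?_
  · rw [hcap ω n hn]
    exact bundleValue_nonneg (expTicket_nonneg _ X) ω n
  · rw [hcap ω N le_rfl, bundleValue, dif_neg (lt_irrefl N)]
    calc (1 : ℝ) = Real.exp (-(C ^ 2 / (2 * (K * N)))) *
          Real.exp (η * C - η ^ 2 * (K * N) / 2) := by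
          rw [← Real.exp_add, eq_comm, Real.exp_eq_one_iff, hη]
          field_simp
          ring
      _ ≤ Real.exp (-(C ^ 2 / (2 * (K * N)))) *
          Real.exp (η * totalGain X ω - η ^ 2 * (K * N) / 2) := by
          have : η * C ≤ η * totalGain X ω := mul_le_mul_of_nonneg_left hω hη0
          gcongr
      _ ≤ _ := mul_le_mul_of_nonneg_left (exp_le_bundle_expTicket hK hη0 hX hmean ω)
          (Real.exp_pos _).le

end Concentration

/-! ### The excess loss of the Bayes strategy -/

section Bayes

variable {Y D : Type*} [Fintype Y] {K N : ℕ}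

lemma exists_isBayes [Fintype D] [Nonempty D] [LinearOrder D] :
    ∃ A : DMStrategy Y D K N, IsBayes A := by
  have h : ∀ (l : LossFn Y D K) (P : Forecast Y K),
      ∃ d, IsLeast {d | ∀ d', expectedLoss l P d ≤ expectedLoss l P d'} d := by
    intro l P
    have hne : {d | ∀ d', expectedLoss l P d ≤ expectedLoss l P d'}.Nonempty :=
      Finite.exists_min (expectedLoss l P)
    obtain ⟨d, hd⟩ := (Set.toFinite _).exists_minimal hne
    exact ⟨d, hd.1, fun d' hd' => (le_total d d').elim id fun h => hd.2 hd' h⟩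
  choose a ha using h
  exact ⟨fun _ _ l P => a l P, fun _ _ l P => ha l P⟩

/-- A competitor of a strategy for Decision Maker: a choice of a decision at each step that may
depend on everything known after Decision Maker's move. -/
abbrev Competitor (Y D : Type*) [Fintype Y] (K N : ℕ) : Type _ :=
  (n : Fin N) → (Fin n → Round Y D K) → LossFn Y D K → Forecast Y K → D → D

/-- The decisions of the competitor `e` in the play `ω`. -/
def Competitor.decision (e : Competitor Y D K N) (ω : Play Y D K N) (n : Fin N) : D :=
  e n (fun i => ω ⟨i, i.2.trans n.2⟩) (ω n).loss (ω n).forecast (ω n).decision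

/-- A strategy for Decision Maker, as a competitor. It ignores the decisions actually made. -/
def DMStrategy.toCompetitor (A : DMStrategy Y D K N) : Competitor Y D K N :=
  fun n past l P _ => A n (fun i => ((past i).loss, (past i).forecast, (past i).obs)) l P

/-- The loss at each step of the strategy `A` in excess of the loss of the competitor `e`. -/
def excess (A : DMStrategy Y D K N) (e : Competitor Y D K N) : BlockRule Y D K N :=
  fun n past l P d z =>
    (l (A.toCompetitor n past l P d) z : ℝ) - (l (e n past l P d) z : ℝ)

lemma totalGain_excess [Nonempty Y] (A : DMStrategy Y D K N) (e : Competitor Y D K N)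
    (ω : Play Y D K N) :
    totalGain (excess A e) ω = strategyLoss A ω - totalLoss ω (e.decision ω) := by
  rw [totalGain, strategyLoss, totalLoss, totalLoss, ← sum_sub_distrib]
  refine sum_congr rfl fun b _ => ?_
  split_ifs with h
  · have hw : window K (obsSeq ω) b = fun i => (ω ⟨b.1 + i.1, by omega⟩).obs :=
      funext fun i => obsSeq_of_lt ω (by omega)
    rw [hw]
    rfl
  · simp

lemma abs_excess_le_one (A : DMStrategy Y D K N) (e : Competitor Y D K N) (n past l P d z) :
    |excess A e n past l P d z| ≤ 1 := by
  have h1 := (l (A.toCompetitor n past l P d) z).2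
  have h2 := (l (e n past l P d) z).2
  exact abs_le.mpr ⟨by unfold excess; linarith [h1.1, h2.2], by unfold excess; linarith [h1.2, h2.1]⟩

lemma IsBayes.sum_forecast_mul_excess_nonpos [LinearOrder D] {A : DMStrategy Y D K N}
    (hA : IsBayes A) (e : Competitor Y D K N) (n past l P d) :
    ∑ z, P.1 z * excess A e n past l P d z ≤ 0 := by
  have h : expectedLoss l P (A.toCompetitor n past l P d) ≤ expectedLoss l P (e n past l P d) :=
    (hA n _ l P).1 _
  calc ∑ z, P.1 z * excess A e n past l P d z
      = expectedLoss l P (A.toCompetitor n past l P d) - expectedLoss l P (e n past l P d) := by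
        rw [expectedLoss, expectedLoss, ← sum_sub_distrib]
        exact sum_congr rfl fun z _ => by unfold excess; ring
    _ ≤ 0 := sub_nonpos.mpr h

variable [Nonempty Y] [LinearOrder D]

lemma IsBayes.upperProb_excess_le {A : DMStrategy Y D K N} (hA : IsBayes A) (hK : 1 ≤ K)
    (hN : 0 < N) (e : Competitor Y D K N) {C : ℝ} (hC : 0 ≤ C) :
    upperProb {ω | C ≤ strategyLoss A ω - totalLoss ω (e.decision ω)} ≤
      Real.exp (-(C ^ 2 / (2 * (K * N)))) := by
  simpa only [totalGain_excess] using upperProb_totalGain_le hK hN (abs_excess_le_one A e)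
    (hA.sum_forecast_mul_excess_nonpos e) hC

lemma IsBayes.upperProb_average_excess_le {A : DMStrategy Y D K N} (hA : IsBayes A) (hK : 1 ≤ K)
    (hN : 0 < N) (e : Competitor Y D K N) {δ : ℝ} (hδ : 0 < δ) :
    upperProb {ω | 1 / N * strategyLoss A ω - 1 / N * totalLoss ω (e.decision ω) ≥ δ} ≤
      5 * (K / (δ ^ 2 * N)) * Real.exp (-(δ ^ 2 * N / (4 * K))) := by
  have hK0 : (0 : ℝ) < K := by exact_mod_cast hK
  have hN0 : (0 : ℝ) < N := by exact_mod_cast hN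
  have hset : {ω : Play Y D K N |
      1 / N * strategyLoss A ω - 1 / N * totalLoss ω (e.decision ω) ≥ δ} =
      {ω | δ * N ≤ strategyLoss A ω - totalLoss ω (e.decision ω)} := by
    ext ω
    rw [Set.mem_ofPred_eq, Set.mem_ofPred_eq, ← mul_sub, one_div_mul_eq_div, ge_iff_le,
      le_div_iff₀ hN0]
  rw [hset]
  refine (hA.upperProb_excess_le hK hN e (by positivity)).trans ?_
  -- with `t = δ ^ 2 * N / (4 * K)` the claim is `exp (-2 * t) ≤ 5 / (4 * t) * exp (-t)`
  set t : ℝ := δ ^ 2 * N / (4 * K) with ht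
  have ht0 : 0 < t := by positivity
  have h1 : -((δ * N) ^ 2 / (2 * (K * N))) = -t + -t := by
    rw [ht]
    field_simp
    ring
  have h2 : 5 * (K / (δ ^ 2 * N)) = 5 / 4 / t := by
    rw [ht]
    field_simp
  rw [h1, h2, Real.exp_add]
  refine mul_le_mul_of_nonneg_right ?_ (Real.exp_pos _).le
  rw [Real.exp_neg, inv_le_comm₀ (Real.exp_pos _) (by positivity), inv_div]
  have := Real.add_one_le_exp t
  linarith [show t / (5 / 4) ≤ t by rw [div_le_iff₀ (by norm_num)]; linarith]

end Bayes

end KStep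

theorem theorem5p1 {Y D : Type*} [Fintype Y] [Nonempty Y] [Fintype D] [Nonempty D] [LinearOrder D]
    (K N : ℕ) (hK : 1 ≤ K) (hKN : K < N) :
    ∃ A : KStep.DMStrategy Y D K N, KStep.IsBayes A ∧
      (∀ ε : ℝ, 0 < ε → ε < 0.3 →
        KStep.upperProb {ω : KStep.Play Y D K N |
          KStep.strategyLoss A ω - KStep.actualLoss ω ≥ 2 * √(K * N * Real.log (1 / ε))} ≤ ε) ∧
      (∀ δ : ℝ, 0 < δ →
        KStep.upperProb {ω : KStep.Play Y D K N |
          1 / N * KStep.strategyLoss A ω - 1 / N * KStep.actualLoss ω ≥ δ} ≤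
            5 * (K / (δ ^ 2 * N)) * Real.exp (-(δ ^ 2 * N / (4 * K)))) ∧
      (∀ B : KStep.DMStrategy Y D K N, ∀ δ : ℝ, 0 < δ →
        KStep.upperProb {ω : KStep.Play Y D K N |
          1 / N * KStep.strategyLoss A ω - 1 / N * KStep.strategyLoss B ω ≥ δ} ≤
            5 * (K / (δ ^ 2 * N)) * Real.exp (-(δ ^ 2 * N / (4 * K)))) := by
  obtain ⟨A, hA⟩ := KStep.exists_isBayes (Y := Y) (D := D) (K := K) (N := N)
  have hN : 0 < N := by omega
  refine ⟨A, hA, fun ε hε hε' => ?_, fun δ hδ => ?_, fun B δ hδ => ?_⟩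
  · have hK0 : (0 : ℝ) < K := by exact_mod_cast hK
    have hN0 : (0 : ℝ) < N := by exact_mod_cast hN
    have hlog : 0 ≤ Real.log (1 / ε) := by
      apply Real.log_nonneg
      rw [le_div_iff₀ hε]
      linarith
    refine (hA.upperProb_excess_le hK hN (fun _ _ _ _ d => d)
      (C := 2 * √(K * N * Real.log (1 / ε))) (by positivity)).trans ?_
    -- the exponent is `-2 * log (1 / ε)`, so the bound is `ε ^ 2`
    have h : -((2 * √(K * N * Real.log (1 / ε))) ^ 2 / (2 * (K * N))) =
        Real.log ε + Real.log ε := by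
      rw [mul_pow, Real.sq_sqrt (by positivity), one_div, Real.log_inv]
      field_simp
      ring
    rw [h, Real.exp_add, Real.exp_log hε]
    exact mul_le_of_le_one_left hε.le (by linarith)
  · exact hA.upperProb_average_excess_le hK hN (fun _ _ _ _ d => d) hδ
  · exact hA.upperProb_average_excess_le hK hN B.toCompetitor hδ
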